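/- Call a real sequence $M=(M_n)_{n\in\mathbb N}$ a *weight* if $1=M_0\le M_1\le M_2\le\dots$ and $M$ is log-convex, i.e. $M_{n+1}^2\le M_nM_{n+2}$ for all $n$. For an interval $I\subset\mathbb R$ let $\mathcal Q(I,M)$ be the set of smooth functions $f:I\to\mathbb R$ (one-sided derivatives at end points in $I$) for which there are constants $C,R>0$ with $|f^{(n)}(x)|\le C R^n\, n!\, M_n$ for all $n\in\mathbb N$, $x\in I$. Let $\mathcal Q_1(M)$ be the set of germs at $0\in\mathbb R$ of functions from $\mathcal Q([-\varepsilon,\varepsilon],M)$, $\varepsilon>0$; let $\mathcal Q_1(M)^+$ be the set of right-hand germs at $0$ of functions from $\mathcal Q([0,\varepsilon],M)$, $\varepsilon>0$; and let $\mathcal O_1$ be the set of germs at $0\in\mathbb R$ of real analytic functions. Call $\mathcal Q_1(M)$ *quasianalytic* if every germ in it with vanishing Taylor series at $0$ is zero. **Theorem.** Let $M$ be a weight and let $M^{[p]}$, $p\in\mathbb N$, be weights with $M^{[p]}_j\le M^{[q]}_j$ for all $j$ and all $p\le q$, such that every $\mathcal Q_1(M^{[p]})$ is quasianalytic. If $$\mathcal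 O_1\subsetneq \mathcal Q_1(M)\subset\bigcup_{p\in\mathbb N}\mathcal Q_1(M^{[p]}),$$ then $$\mathcal Q_1(M)^+\setminus\bigcup_{p\in\mathbb N}\mathcal Q_1(M^{[p]})\neq\emptyset,$$ i.e. there is a right-hand germ in $\mathcal Q_1(M)^+$ that is not the restriction of any germ belonging to $\bigcup_{p\in\mathbb N}\mathcal Q_1(M^{[p]})$. -/

import Mathlib

open Filter Topology
open scoped ContDiff

namespace DenjoyCarleman

/-- An admissible weight sequence: `1 = M 0 ≤ M 1 ≤ M 2 ≤ …`, and `M` is log-convex. -/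
structure IsLogConvexWeight (M : ℕ → ℝ) : Prop where
  zero_eq_one : M 0 = 1
  monotone : Monotone M
  log_convex : ∀ n : ℕ, M (n + 1) ^ 2 ≤ M n * M (n + 2)

/-- The Denjoy-Carleman class `𝒬(I, M)` on an interval `I`: functions that are smooth on `I`
(with one-sided derivatives at the end points that belong to `I`) and satisfy
`|f⁽ⁿ⁾(x)| ≤ C Rⁿ n! Mₙ` for all `n` and all `x ∈ I`, with some constants `C, R > 0`. -/
def carlemanClass (I : Set ℝ) (M : ℕ → ℝ) : Set (ℝ → ℝ) :=
  {f | ContDiffOn ℝ ∞ f I ∧ ∃ C > 0, ∃ R > 0, ∀ n : ℕ, ∀ x ∈ I,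
    |iteratedDerivWithin n f I x| ≤ C * R ^ n * (n.factorial : ℝ) * M n}

/-- `𝒬₁(M)`: the germs at `0 ∈ ℝ` of functions that belong to the class of `M` near `0`. -/
def germs (M : ℕ → ℝ) : Set (Germ (𝓝 (0 : ℝ)) ℝ) :=
  {g | ∃ ε > 0, ∃ f ∈ carlemanClass (Set.Icc (-ε) ε) M, (f : Germ (𝓝 (0 : ℝ)) ℝ) = g}

/-- `𝒬₁(M)⁺`: the right-hand side germs at `0` of functions from `𝒬([0, ε], M)`, `ε > 0`. -/
def rightGerms (M : ℕ → ℝ) : Set (Germ (𝓝[≥] (0 : ℝ)) ℝ) :=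
  {g | ∃ ε > 0, ∃ f ∈ carlemanClass (Set.Icc 0 ε) M, (f : Germ (𝓝[≥] (0 : ℝ)) ℝ) = g}

/-- `𝒪₁`: the germs at `0 ∈ ℝ` of real analytic functions. -/
def analyticGerms : Set (Germ (𝓝 (0 : ℝ)) ℝ) :=
  {g | ∃ f : ℝ → ℝ, AnalyticAt ℝ f 0 ∧ (f : Germ (𝓝 (0 : ℝ)) ℝ) = g}

/-- `𝒬₁(M)` is quasianalytic: a germ in it whose Taylor series at `0` vanishes is zero. -/
def IsQuasianalytic (M : ℕ → ℝ) : Prop :=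
  ∀ f : ℝ → ℝ, (f : Germ (𝓝 (0 : ℝ)) ℝ) ∈ germs M →
    (∀ n : ℕ, iteratedDeriv n f 0 = 0) → (f : Germ (𝓝 (0 : ℝ)) ℝ) = 0

/-- Restriction of a germ at `0` to a right-hand side germ at `0`. -/
def restrictRight (g : Germ (𝓝 (0 : ℝ)) ℝ) : Germ (𝓝[≥] (0 : ℝ)) ℝ :=
  g.compTendsto (fun x : ℝ => x) (tendsto_id.mono_left nhdsWithin_le_nhds)

theorem restrictRight_coe (f : ℝ → ℝ) :
    restrictRight (f : Germ (𝓝 (0 : ℝ)) ℝ) = (f : Germ (𝓝[≥] (0 : ℝ)) ℝ) := rfl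

end DenjoyCarleman

/-! Non-analytic germs force `M` to outgrow every geometric sequence (`exists_pow_le`). So on `[0,
∞)` each fraction `1 / (x + a)`, `a > 0`, obeys the bounds of `M` with `R = 1`, and with small
weights countably many of them may be summed over any index set without leaving the right-hand
class. `exists_poles` takes poles approaching every `-1 / (m + 1)` from the left, with the values at
these points blowing up.

If all such sums extended, the Cantor space of index sets would be the union of the sets of
selections whose sum extends to `[-1 / (m + 1), 1 / (m + 1)]` in the class of `N p` with both
constants `m + 1`. These sets are closed by compactness, so by Baire one has an interior point, and
switching a single late index `k` stays inside it. The two extensions differ by the `k`-th fraction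
on the right, hence by quasianalyticity also on the left. Its value at `-1 / (m + 1)` is then at
most `2 * (m + 1)` (`abs_pole_le`), against the blow-up. -/

namespace DenjoyCarleman

/-! ### Chains of one-sided derivatives -/

/-- `G` is a chain of one-sided derivatives on `I`: each `G (n + 1)` is the derivative of `G n`
within `I`. -/
def IsDerivChain (I : Set ℝ) (G : ℕ → ℝ → ℝ) : Prop :=
  ∀ n : ℕ, ∀ x ∈ I, HasDerivWithinAt (G n) (G (n + 1) x) I x

namespace IsDerivChain

variable {I J : Set ℝ} {G H : ℕ → ℝ → ℝ}

theorem mono (h : IsDerivChain I G) (hJ : J ⊆ I) : IsDerivChain J G :=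
  fun n x hx => (h n x (hJ hx)).mono hJ

theorem sub (hG : IsDerivChain I G) (hH : IsDerivChain I H) :
    IsDerivChain I (fun n x => G n x - H n x) :=
  fun n x hx => (hG n x hx).sub (hH n x hx)

theorem const_mul (c : ℝ) (hG : IsDerivChain I G) : IsDerivChain I (fun n x => c * G n x) :=
  fun n x hx => (hG n x hx).const_mul c

theorem comp_add_const (hG : IsDerivChain I G) (s : ℝ) (hJ : ∀ x ∈ J, x + s ∈ I) :
    IsDerivChain J (fun n x => G n (x + s)) := by
  intro n x hx
  have h1 : HasDerivWithinAt (fun x : ℝ => x + s) 1 J x := (hasDerivWithinAt_id x J).add_const s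
  have h2 := (hG n (x + s) (hJ x hx)).comp x h1 hJ
  rw [mul_one] at h2
  exact h2

theorem iteratedDerivWithin_eq (hG : IsDerivChain I G) (hI : UniqueDiffOn ℝ I) (n : ℕ) :
    ∀ x ∈ I, iteratedDerivWithin n (G 0) I x = G n x := by
  induction n with
  | zero => simp
  | succ n ih =>
    intro x hx
    rw [iteratedDerivWithin_succ, derivWithin_congr ih (ih x hx)]
    exact (hG n x hx).derivWithin (hI x hx)

theorem contDiffOn (hG : IsDerivChain I G) (hI : UniqueDiffOn ℝ I) :
    ContDiffOn ℝ ∞ (G 0) I := by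
  refine contDiffOn_of_differentiableOn_deriv fun m _ x hx => ?_
  exact ((hG m x hx).congr (hG.iteratedDerivWithin_eq hI m)
    (hG.iteratedDerivWithin_eq hI m x hx)).differentiableWithinAt

/-- The mean value inequality, used twice. Unlike differentiability, this estimate survives
pointwise limits and summation; `of_abs_remainder_le` recovers the derivatives from it. -/
theorem abs_remainder_le (hG : IsDerivChain I G) (hI : Convex ℝ I) {n : ℕ} {B : ℝ}
    (hB : ∀ x ∈ I, |G (n + 2) x| ≤ B) {x y : ℝ} (hx : x ∈ I) (hy : y ∈ I) :
    |G n y - G n x - G (n + 1) x * (y - x)| ≤ B * (y - x) ^ 2 := by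
  have hsub : Set.uIcc x y ⊆ I := hI.ordConnected.uIcc_subset hx hy
  have hB0 : 0 ≤ B := (abs_nonneg _).trans (hB x hx)
  have hd : ∀ t ∈ Set.uIcc x y, HasDerivWithinAt (fun t => G n t - G (n + 1) x * t)
      (G (n + 1) t - G (n + 1) x) (Set.uIcc x y) t := by
    intro t ht
    have h1 := ((hG n t (hsub ht)).mono hsub).sub
      ((hasDerivWithinAt_id t (Set.uIcc x y)).const_mul (G (n + 1) x))
    rw [mul_one] at h1
    exact h1
  have hb : ∀ t ∈ Set.uIcc x y, ‖G (n + 1) t - G (n + 1) x‖ ≤ B * |y - x| := by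
    intro t ht
    have h2 := hI.norm_image_sub_le_of_norm_hasDerivWithin_le (f := G (n + 1))
      (f' := G (n + 2)) (fun z hz => hG (n + 1) z hz) (fun z hz => hB z hz) hx (hsub ht)
    refine h2.trans (mul_le_mul_of_nonneg_left ?_ hB0)
    exact Set.abs_sub_left_of_mem_uIcc ht
  have h3 := (convex_uIcc x y).norm_image_sub_le_of_norm_hasDerivWithin_le hd hb
    Set.left_mem_uIcc Set.right_mem_uIcc
  rw [Real.norm_eq_abs, Real.norm_eq_abs, mul_assoc, ← abs_mul, ← sq,
    abs_of_nonneg (sq_nonneg (y - x))] at h3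
  convert h3 using 2
  ring

theorem of_abs_remainder_le
    (h : ∀ n, ∃ B, ∀ x ∈ I, ∀ y ∈ I, |G n y - G n x - G (n + 1) x * (y - x)| ≤ B * (y - x) ^ 2) :
    IsDerivChain I G := by
  intro n x hx
  obtain ⟨B, hB⟩ := h n
  rw [hasDerivWithinAt_iff_isLittleO]
  have h1 : (fun y => G n y - G n x - (y - x) • G (n + 1) x) =O[𝓝[I] x]
      fun y => (y - x) ^ 2 := by
    refine Asymptotics.IsBigO.of_bound B ?_
    filter_upwards [self_mem_nhdsWithin] with y hy
    rw [smul_eq_mul, mul_comm (y - x), Real.norm_eq_abs, Real.norm_eq_abs,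
      abs_of_nonneg (sq_nonneg (y - x))]
    exact hB x hx y hy
  refine h1.trans_isLittleO ?_
  have h2 : Tendsto (fun y : ℝ => y - x) (𝓝[I] x) (𝓝 0) := by
    have : Tendsto (fun y : ℝ => y - x) (𝓝 x) (𝓝 (x - x)) :=
      (continuous_id.sub continuous_const).tendsto x
    rw [sub_self] at this
    exact this.mono_left nhdsWithin_le_nhds
  have h3 : (fun z : ℝ => z ^ 2) =o[𝓝 0] fun z : ℝ => z := by
    simpa using Asymptotics.isLittleO_pow_pow (𝕜 := ℝ) (show 1 < 2 by norm_num)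
  exact h3.comp_tendsto h2

theorem eq_zero_of_eqOn (hG : IsDerivChain I G) (hI : UniqueDiffOn ℝ I)
    (h : ∀ x ∈ I, G 0 x = 0) (n : ℕ) : ∀ x ∈ I, G n x = 0 := by
  induction n with
  | zero => exact h
  | succ n ih =>
    intro x hx
    refine (hI x hx).eq_deriv _ (hG n x hx) ?_
    exact (hasDerivWithinAt_const x I (0 : ℝ)).congr ih (ih x hx)

theorem mem_carlemanClass (hG : IsDerivChain I G) (hI : UniqueDiffOn ℝ I) {M : ℕ → ℝ}
    {C R : ℝ} (hC : 0 < C) (hR : 0 < R)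
    (hb : ∀ n : ℕ, ∀ x ∈ I, |G n x| ≤ C * R ^ n * (n.factorial : ℝ) * M n) :
    G 0 ∈ carlemanClass I M :=
  ⟨hG.contDiffOn hI, C, hC, R, hR, fun n x hx => by
    rw [hG.iteratedDerivWithin_eq hI n x hx]; exact hb n x hx⟩

theorem iteratedDeriv_eq (hG : IsDerivChain I G) {x : ℝ} (hx : I ∈ 𝓝 x) (n : ℕ) :
    iteratedDeriv n (G 0) x = G n x := by
  have hU : interior I ∈ 𝓝 x := interior_mem_nhds.2 hx
  have hG' := hG.mono interior_subset
  rw [← iteratedDerivWithin_of_isOpen isOpen_interior (mem_of_mem_nhds hU)]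
  exact hG'.iteratedDerivWithin_eq isOpen_interior.uniqueDiffOn n x (mem_of_mem_nhds hU)

/-- Derivative growth `C * R ^ n * n!` forces analyticity. -/
theorem analyticAt_zero (hG : IsDerivChain I G) (hI : I ∈ 𝓝 (0 : ℝ)) {C R : ℝ} (hR : 0 < R)
    (hb : ∀ n : ℕ, ∀ x ∈ I, |G n x| ≤ C * R ^ n * (n.factorial : ℝ)) :
    AnalyticAt ℝ (G 0) 0 := by
  obtain ⟨r, hr, hrI⟩ := Metric.mem_nhds_iff.1 hI
  let p : FormalMultilinearSeries ℝ ℝ ℝ :=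
    FormalMultilinearSeries.ofScalars ℝ fun n => G n 0 / (n.factorial : ℝ)
  have hp : ∀ n, p.coeff n = G n 0 / (n.factorial : ℝ) := by
    intro n; simp [p, FormalMultilinearSeries.coeff_ofScalars]
  refine ⟨p, hasFPowerSeriesAt_iff.2 ?_⟩
  have h0I : (0 : ℝ) ∈ I := mem_of_mem_nhds hI
  filter_upwards [Metric.ball_mem_nhds (0 : ℝ) hr,
    Metric.ball_mem_nhds (0 : ℝ) (show 0 < 1 / (2 * R) by positivity)] with z hz1 hz2
  have hfac : ∀ n : ℕ, (0 : ℝ) < n.factorial := fun n => by positivity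
  have hC : 0 ≤ C := by
    have := (abs_nonneg _).trans (hb 0 0 h0I)
    simpa using this
  have hRz : R * |z| ≤ 1 / 2 := by
    rw [Metric.mem_ball, dist_zero_right, Real.norm_eq_abs, lt_div_iff₀ (by positivity)] at hz2
    linarith
  have hRz0 : 0 ≤ R * |z| := by positivity
  have hterm : ∀ n, ‖z ^ n • p.coeff n‖ ≤ C * (1 / 2) ^ n := by
    intro n
    rw [hp, norm_smul, norm_pow, norm_div, Real.norm_eq_abs, Real.norm_eq_abs, Real.norm_eq_abs,
      abs_of_pos (hfac n)]
    calc |z| ^ n * (|G n 0| / n.factorial) ≤ |z| ^ n * (C * R ^ n) := by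
          gcongr
          rw [div_le_iff₀ (hfac n)]
          exact hb n 0 h0I
      _ = C * (R * |z|) ^ n := by rw [mul_pow]; ring
      _ ≤ C * (1 / 2) ^ n := by gcongr
  have hgeom : Summable fun n : ℕ => C * (1 / 2 : ℝ) ^ n :=
    (summable_geometric_of_lt_one (by norm_num) (by norm_num)).mul_left C
  have hsum : Summable fun n => z ^ n • p.coeff n := Summable.of_norm_bounded hgeom hterm
  rw [zero_add]
  -- The Lagrange remainder needs a nondegenerate interval between `0` and `z`.
  by_cases hz : z = 0
  · subst hz
    have h0 : HasSum (fun n => (0 : ℝ) ^ n • p.coeff n) ((0 : ℝ) ^ 0 • p.coeff 0) :=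
      hasSum_single 0 fun n hn => by simp [hn]
    have he : (0 : ℝ) ^ 0 • p.coeff 0 = G 0 0 := by rw [hp]; simp
    rwa [he] at h0
  refine (hsum.hasSum_iff_tendsto_nat).2 ?_
  rw [← tendsto_add_atTop_iff_nat 1]
  have hsub : Set.uIcc 0 z ⊆ I := by
    refine Set.Subset.trans ?_ hrI
    exact (convex_ball (0 : ℝ) r).ordConnected.uIcc_subset (Metric.mem_ball_self hr) hz1
  have hu : UniqueDiffOn ℝ (Set.uIcc 0 z) := uniqueDiffOn_uIcc (Ne.symm hz)
  have hch := hG.mono hsub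
  rw [tendsto_iff_norm_sub_tendsto_zero]
  have hlim : Tendsto (fun n : ℕ => C * (1 / 2 : ℝ) ^ (n + 1)) atTop (𝓝 0) :=
    (tendsto_add_atTop_iff_nat 1).2 hgeom.tendsto_atTop_zero
  refine squeeze_zero (fun _ => norm_nonneg _) (fun n => ?_) hlim
  obtain ⟨x', hx', he⟩ := taylor_mean_remainder_lagrange (n := n) (Ne.symm hz)
    ((hch.contDiffOn hu).of_le (by exact_mod_cast le_top))
    (((hch.contDiffOn hu).differentiableOn_iteratedDerivWithin (by exact_mod_cast WithTop.coe_lt_top _)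
      hu).mono Set.Ioo_subset_Icc_self)
  have hx'' : x' ∈ Set.uIcc 0 z := Set.Ioo_subset_Icc_self hx'
  rw [hch.iteratedDerivWithin_eq hu _ x' hx'', taylor_within_apply, sub_zero] at he
  have hse : ∑ i ∈ Finset.range (n + 1), z ^ i • p.coeff i =
      ∑ k ∈ Finset.range (n + 1),
        ((k.factorial : ℝ)⁻¹ * z ^ k) • iteratedDerivWithin k (G 0) (Set.uIcc 0 z) 0 := by
    refine Finset.sum_congr rfl fun k _ => ?_
    rw [hch.iteratedDerivWithin_eq hu k 0 Set.left_mem_uIcc, hp, smul_eq_mul, smul_eq_mul]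
    field_simp
  rw [norm_sub_rev, hse, he, norm_div, norm_mul, norm_pow, Real.norm_eq_abs, Real.norm_eq_abs,
    Real.norm_eq_abs, abs_of_pos (hfac _), div_le_iff₀ (hfac _)]
  calc |G (n + 1) x'| * |z| ^ (n + 1)
      ≤ (C * R ^ (n + 1) * ((n + 1).factorial : ℝ)) * |z| ^ (n + 1) := by
        gcongr
        exact hb _ _ (hsub hx'')
    _ = C * (R * |z|) ^ (n + 1) * ((n + 1).factorial : ℝ) := by rw [mul_pow]; ring
    _ ≤ C * (1 / 2) ^ (n + 1) * ((n + 1).factorial : ℝ) := by gcongr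

end IsDerivChain

theorem _root_.ContDiffOn.isDerivChain_iteratedDerivWithin {I : Set ℝ} {f : ℝ → ℝ}
    (hf : ContDiffOn ℝ ∞ f I) (hI : UniqueDiffOn ℝ I) :
    IsDerivChain I (fun n => iteratedDerivWithin n f I) := by
  intro n x hx
  have h := (hf.differentiableOn_iteratedDerivWithin (m := n)
    (by exact_mod_cast WithTop.coe_lt_top _) hI) x hx
  have h2 := h.hasDerivWithinAt
  rwa [← iteratedDerivWithin_succ] at h2

/-! ### Growth of weights and analyticity -/

theorem IsLogConvexWeight.one_le {M : ℕ → ℝ} (hM : IsLogConvexWeight M) (n : ℕ) : 1 ≤ M n :=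
  hM.zero_eq_one ▸ hM.monotone (Nat.zero_le n)

theorem germs_subset_analyticGerms {M : ℕ → ℝ} {b : ℝ} (hb : 0 < b) (h : ∀ n, M n ≤ b ^ n) :
    germs M ⊆ analyticGerms := by
  rintro _ ⟨ε, hε, f, ⟨hf, C, hC, R, hR, hbd⟩, rfl⟩
  refine ⟨f, ?_, rfl⟩
  have hI : UniqueDiffOn ℝ (Set.Icc (-ε) ε) := uniqueDiffOn_Icc (by linarith)
  have hG := hf.isDerivChain_iteratedDerivWithin hI
  have := hG.analyticAt_zero (Icc_mem_nhds (by linarith) hε) (C := C) (R := R * b)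
    (mul_pos hR hb) fun n x hx => ?_
  · simpa using this
  · calc _ ≤ C * R ^ n * (n.factorial : ℝ) * M n := hbd n x hx
      _ ≤ C * R ^ n * (n.factorial : ℝ) * b ^ n := by gcongr; exact h n
      _ = _ := by rw [mul_pow]; ring

/-- A weight whose class contains a non-analytic germ grows faster than any geometric sequence. -/
theorem IsLogConvexWeight.exists_pow_le {M : ℕ → ℝ} (hM : IsLogConvexWeight M)
    (hne : ¬ germs M ⊆ analyticGerms) {b : ℝ} (hb : 0 < b) :
    ∃ D > 0, ∀ n, b ^ (n + 1) ≤ D * M n := by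
  have hpos : ∀ n, 0 < M n := fun n => zero_lt_one.trans_le (hM.one_le n)
  -- By log-convexity the ratios `M (n + 1) / M n` increase: once one reaches `b`, all later ones
  -- do. If none does, `M n ≤ b ^ n` and the class is analytic.
  by_cases hex : ∃ n, b * M n ≤ M (n + 1)
  · obtain ⟨n₀, hn₀⟩ := hex
    have hstep : ∀ n, n₀ ≤ n → b * M n ≤ M (n + 1) := by
      intro n hn
      induction n, hn using Nat.le_induction with
      | base => exact hn₀
      | succ n _ ih =>
        have h1 := hM.log_convex n
        have h2 : M n * (b * M (n + 1)) ≤ M n * M (n + 2) := by nlinarith [hpos (n + 1)]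
        exact le_of_mul_le_mul_left h2 (hpos n)
    refine ⟨∑ i ∈ Finset.range (n₀ + 1), b ^ (i + 1), ?_, fun n => ?_⟩
    · exact Finset.sum_pos (fun i _ => by positivity) (by simp)
    set D := ∑ i ∈ Finset.range (n₀ + 1), b ^ (i + 1) with hD
    have hD0 : 0 ≤ D := Finset.sum_nonneg fun i _ => by positivity
    have hlow : ∀ i, i ≤ n₀ → b ^ (i + 1) ≤ D * M i := by
      intro i hi
      have h1 : b ^ (i + 1) ≤ D :=
        Finset.single_le_sum (f := fun i => b ^ (i + 1)) (fun i _ => by positivity)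
          (Finset.mem_range.2 (Nat.lt_succ_of_le hi))
      exact h1.trans (le_mul_of_one_le_right hD0 (hM.one_le i))
    induction n with
    | zero => exact hlow 0 (Nat.zero_le _)
    | succ n ih =>
      rcases Nat.lt_or_ge n n₀ with h | h
      · exact hlow _ h
      · calc b ^ (n + 1 + 1) = b * b ^ (n + 1) := by ring
          _ ≤ b * (D * M n) := by gcongr
          _ = D * (b * M n) := by ring
          _ ≤ D * M (n + 1) := by gcongr; exact hstep n h
  · push Not at hex
    refine absurd (germs_subset_analyticGerms hb fun n => ?_) hne
    induction n with
    | zero => simp [hM.zero_eq_one]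
    | succ n ih =>
      calc M (n + 1) ≤ b * M n := (hex n).le
        _ ≤ b * b ^ n := by gcongr
        _ = b ^ (n + 1) := by ring

/-! ### Simple fractions -/

/-- The `n`-th derivative of `x ↦ 1 / (x + a)`. -/
noncomputable def poleDeriv (a : ℝ) (n : ℕ) (x : ℝ) : ℝ :=
  (-1) ^ n * (n.factorial : ℝ) * ((x + a) ^ (n + 1))⁻¹

theorem isDerivChain_poleDeriv {a : ℝ} {I : Set ℝ} (h : ∀ x ∈ I, x + a ≠ 0) :
    IsDerivChain I (poleDeriv a) := by
  intro n x hx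
  have h0 := h x hx
  have h1 : HasDerivWithinAt (fun x : ℝ => (x + a) ^ (n + 1))
      (((n + 1 : ℕ) : ℝ) * (x + a) ^ n * 1) I x := by
    simpa using ((hasDerivWithinAt_id x I).add_const a).fun_pow (n + 1)
  have h2 := (h1.fun_inv (pow_ne_zero _ h0)).const_mul ((-1) ^ n * (n.factorial : ℝ))
  have he : poleDeriv a (n + 1) x = (-1) ^ n * (n.factorial : ℝ) *
      (-(((n + 1 : ℕ) : ℝ) * (x + a) ^ n * 1) / ((x + a) ^ (n + 1)) ^ 2) := by
    rw [poleDeriv, Nat.factorial_succ]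
    push_cast
    field_simp
    ring
  rw [he]
  exact h2

theorem abs_poleDeriv_le {a b x : ℝ} (hb : 0 < b) (hx : b ≤ x + a) (n : ℕ) :
    |poleDeriv a n x| ≤ (n.factorial : ℝ) * b⁻¹ ^ (n + 1) := by
  have h0 : 0 < x + a := hb.trans_le hx
  rw [poleDeriv, abs_mul, abs_mul, abs_pow, abs_neg, abs_one, one_pow, one_mul, ← inv_pow,
    abs_of_nonneg (by positivity : (0 : ℝ) ≤ n.factorial), abs_of_nonneg (by positivity)]
  gcongr

/-! ### Propagation of zeros to the left -/

/-- In a quasianalytic class on `[-δ, δ]`, vanishing on `[0, δ]` forces vanishing at `-δ`. -/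
theorem IsQuasianalytic.apply_neg_eq_zero {M : ℕ → ℝ} (hq : IsQuasianalytic M) {δ : ℝ}
    (hδ : 0 < δ) {H : ℕ → ℝ → ℝ} (hH : IsDerivChain (Set.Icc (-δ) δ) H) {C R : ℝ} (hC : 0 < C)
    (hR : 0 < R) (hb : ∀ n : ℕ, ∀ x ∈ Set.Icc (-δ) δ, |H n x| ≤ C * R ^ n * (n.factorial : ℝ) * M n)
    (h0 : ∀ x ∈ Set.Icc 0 δ, H 0 x = 0) : H 0 (-δ) = 0 := by
  let S : Set ℝ := {x | x ∈ Set.Icc (-δ) 0 ∧ ∀ y ∈ Set.Icc x δ, H 0 y = 0}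
  have hS0 : (0 : ℝ) ∈ S := ⟨⟨by linarith, le_rfl⟩, h0⟩
  have hbdd : BddBelow S := ⟨-δ, fun x hx => hx.1.1⟩
  set s := sInf S with hs
  have hsl : -δ ≤ s := le_csInf ⟨0, hS0⟩ fun x hx => hx.1.1
  have hsu : s ≤ 0 := csInf_le hbdd hS0
  have hright : ∀ y, s < y → y ≤ δ → H 0 y = 0 := by
    intro y hy hyδ
    obtain ⟨x, hx, hxy⟩ := exists_lt_of_csInf_lt ⟨0, hS0⟩ hy
    exact hx.2 y ⟨hxy.le, hyδ⟩
  have hat : H 0 s = 0 := by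
    have hsub : Set.Ioc s δ ⊆ Set.Icc (-δ) δ := fun y hy => ⟨hsl.trans hy.1.le, hy.2⟩
    have hc : ContinuousWithinAt (H 0) (Set.Ioc s δ) s :=
      ((hH 0 s ⟨hsl, by linarith⟩).continuousWithinAt).mono hsub
    have hne : (𝓝[Set.Ioc s δ] s).NeBot := by
      rw [nhdsWithin_Ioc_eq_nhdsGT (by linarith)]
      infer_instance
    refine tendsto_nhds_unique hc.tendsto (tendsto_const_nhds.congr' ?_)
    filter_upwards [self_mem_nhdsWithin] with y hy
    exact (hright y hy.1 hy.2).symm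
  have hzero : ∀ y ∈ Set.Icc s δ, H 0 y = 0 := by
    intro y hy
    rcases hy.1.eq_or_lt with h | h
    · rw [← h, hat]
    · exact hright y h hy.2
  rcases hsl.eq_or_lt with h | hlt
  · rw [h, hat]
  exfalso
  have hflat : ∀ n, H n s = 0 := fun n =>
    (hH.mono (Set.Icc_subset_Icc_left hsl)).eq_zero_of_eqOn (uniqueDiffOn_Icc (by linarith))
      hzero n s ⟨le_rfl, by linarith⟩
  -- Quasianalyticity is given only at `0`, so the chain is translated by `s`; this `ε` keeps the
  -- translate inside `[-δ, δ]`.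
  set ε := min (s + δ) (δ - s) with hε
  have hε0 : 0 < ε := lt_min (by linarith) (by linarith)
  have hmap : ∀ x ∈ Set.Icc (-ε) ε, x + s ∈ Set.Icc (-δ) δ := by
    intro x hx
    have h1 : ε ≤ s + δ := min_le_left _ _
    have h2 : ε ≤ δ - s := min_le_right _ _
    exact ⟨by linarith [hx.1], by linarith [hx.2]⟩
  have hT := hH.comp_add_const s hmap
  have hmem := hT.mem_carlemanClass (uniqueDiffOn_Icc (by linarith)) hC hR
    fun n x hx => hb n (x + s) (hmap x hx)
  have hgerm := hq (fun x => H 0 (x + s)) ⟨ε, hε0, _, hmem, rfl⟩ fun n => by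
    have h1 := hT.iteratedDeriv_eq (Icc_mem_nhds (show -ε < 0 by linarith) hε0) n
    simp only [zero_add, hflat] at h1
    exact h1
  have hev : ∀ᶠ x in 𝓝 (0 : ℝ), H 0 (x + s) = 0 := Germ.coe_eq.1 hgerm
  obtain ⟨η, hη, hη0⟩ := Metric.eventually_nhds_iff.1 hev
  have hmemS : max (-δ) (s - η / 2) ∈ S := by
    refine ⟨⟨le_max_left _ _, max_le (by linarith) (by linarith)⟩, fun y hy => ?_⟩
    rcases le_or_gt s y with h | h
    · exact hzero y ⟨h, hy.2⟩
    · have h1 := (le_max_right (-δ) (s - η / 2)).trans hy.1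
      have h2 := hη0 (y := y - s) (by
        rw [dist_zero_right, Real.norm_eq_abs, abs_lt]
        constructor <;> linarith)
      simpa using h2
  have h1 : s ≤ max (-δ) (s - η / 2) := csInf_le hbdd hmemS
  rcases le_max_iff.1 h1 with h | h <;> linarith

/-! ### Compactness of bounded chains -/

/-- Families `G` of functions bounded by `B` that satisfy the first order Taylor estimates of a
derivative chain on `I`. -/
def boundedChains (I : Set ℝ) (B : ℕ → ℝ) : Set (ℕ → ℝ → ℝ) :=
  {G | (∀ n x, |G n x| ≤ B n) ∧ ∀ n, ∀ x ∈ I, ∀ y ∈ I,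
    |G n y - G n x - G (n + 1) x * (y - x)| ≤ B (n + 2) * (y - x) ^ 2}

theorem isDerivChain_of_mem_boundedChains {I : Set ℝ} {B : ℕ → ℝ} {G : ℕ → ℝ → ℝ}
    (h : G ∈ boundedChains I B) : IsDerivChain I G :=
  IsDerivChain.of_abs_remainder_le fun n => ⟨B (n + 2), h.2 n⟩

/-- Tychonoff: each condition is closed, as it involves only finitely many values of the family. -/
theorem isCompact_boundedChains (I : Set ℝ) (B : ℕ → ℝ) : IsCompact (boundedChains I B) := by
  have hK : IsCompact (Set.pi Set.univ fun n : ℕ => Set.pi Set.univ fun _ : ℝ =>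
      Set.Icc (-B n) (B n)) :=
    isCompact_univ_pi fun n => isCompact_univ_pi fun _ => isCompact_Icc
  refine hK.of_isClosed_subset ?_ ?_
  · simp only [boundedChains, Set.ofPred_and, Set.ofPred_forall]
    refine IsClosed.inter ?_ ?_
    · refine isClosed_iInter fun n => isClosed_iInter fun x => isClosed_le ?_ continuous_const
      fun_prop
    · refine isClosed_iInter fun n => isClosed_iInter fun x => isClosed_iInter fun _ =>
        isClosed_iInter fun y => isClosed_iInter fun _ => isClosed_le ?_ continuous_const
      fun_prop
  · intro G hG n _ x _
    exact abs_le.1 (hG.1 n x)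

/-- By compactness, the parameters for which a pointwise continuous family extends to a bounded
derivative chain form a closed set. -/
theorem isClosed_setOf_exists_boundedChains {T : Type*} [TopologicalSpace T] (I J : Set ℝ)
    (B : ℕ → ℝ) {F : T → ℝ → ℝ} (hF : ∀ x ∈ J, Continuous fun c => F c x) :
    IsClosed {c | ∃ G ∈ boundedChains I B, ∀ x ∈ J, G 0 x = F c x} := by
  have : CompactSpace (boundedChains I B) :=
    isCompact_iff_compactSpace.1 (isCompact_boundedChains I B)
  have hcl : IsClosed {p : boundedChains I B × T | ∀ x ∈ J, p.1.1 0 x = F p.2 x} := by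
    simp only [Set.ofPred_forall]
    refine isClosed_iInter fun x => isClosed_iInter fun hx => isClosed_eq ?_ ?_
    · exact (continuous_apply_apply 0 x).comp (continuous_subtype_val.comp continuous_fst)
    · exact (hF x hx).comp continuous_snd
  convert isClosedMap_snd_of_compactSpace _ hcl using 1
  ext c
  constructor
  · rintro ⟨G, hG, h⟩
    exact ⟨(⟨G, hG⟩, c), h, rfl⟩
  · rintro ⟨⟨G, c'⟩, h, rfl⟩
    exact ⟨G.1, G.2, h⟩

theorem IsDerivChain.indicator_mem_boundedChains {I : Set ℝ} (hI : Convex ℝ I) {B : ℕ → ℝ}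
    (hB : ∀ n, 0 ≤ B n) {G : ℕ → ℝ → ℝ} (hG : IsDerivChain I G)
    (hb : ∀ n, ∀ x ∈ I, |G n x| ≤ B n) : (fun n => I.indicator (G n)) ∈ boundedChains I B := by
  refine ⟨fun n x => ?_, fun n x hx y hy => ?_⟩
  · by_cases hx : x ∈ I
    · simpa [hx] using hb n x hx
    · simpa [hx] using hB n
  · simpa [hx, hy] using hG.abs_remainder_le hI (hb (n + 2)) hx hy

/-! ### Series of chains and their subset sums -/

theorem IsDerivChain.tsum {I : Set ℝ} (hI : Convex ℝ I) {u : ℕ → ℕ → ℝ → ℝ}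
    (hu : ∀ k, IsDerivChain I (u k)) {v : ℕ → ℝ} (hv : Summable v) {B : ℕ → ℝ}
    (hb : ∀ k n, ∀ x ∈ I, |u k n x| ≤ v k * B n) :
    IsDerivChain I (fun n x => ∑' k, u k n x) := by
  have hs : ∀ n, ∀ x ∈ I, Summable fun k => u k n x := fun n x hx =>
    Summable.of_norm_bounded (hv.mul_right (B n)) fun k => hb k n x hx
  refine IsDerivChain.of_abs_remainder_le fun n => ⟨∑' k, v k * B (n + 2), fun x hx y hy => ?_⟩
  have he : ∑' k, u k n y - ∑' k, u k n x - (∑' k, u k (n + 1) x) * (y - x) =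
      ∑' k, (u k n y - u k n x - u k (n + 1) x * (y - x)) := by
    rw [← tsum_mul_right, ← (hs n y hy).tsum_sub (hs n x hx),
      ← ((hs n y hy).sub (hs n x hx)).tsum_sub ((hs (n + 1) x hx).mul_right _)]
  rw [he, ← tsum_mul_right]
  refine tsum_of_norm_bounded (E := ℝ)
    ((hv.mul_right (B (n + 2))).mul_right ((y - x) ^ 2)).hasSum fun k => ?_
  exact (hu k).abs_remainder_le hI (hb k (n + 2)) hx hy

/-- The partial sum over `{k | c k = true}` of a sequence of functions. -/
noncomputable def selectedSum (u : ℕ → ℕ → ℝ → ℝ) (c : ℕ → Bool) (n : ℕ) (x : ℝ) : ℝ :=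
  ∑' k, (if c k then 1 else 0) * u k n x

theorem abs_select_mul_le (b : Bool) (t : ℝ) : |(if b then 1 else 0) * t| ≤ |t| := by
  cases b <;> simp

section SelectedSum

variable {I : Set ℝ} {u : ℕ → ℕ → ℝ → ℝ} {v : ℕ → ℝ} {B : ℕ → ℝ}

theorem summable_select_mul (hv : Summable v) (hb : ∀ k n, ∀ x ∈ I, |u k n x| ≤ v k * B n)
    (c : ℕ → Bool) (n : ℕ) {x : ℝ} (hx : x ∈ I) :
    Summable fun k => (if c k then 1 else 0) * u k n x :=
  Summable.of_norm_bounded (hv.mul_right (B n)) fun k =>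
    (abs_select_mul_le (c k) _).trans (hb k n x hx)

theorem isDerivChain_selectedSum (hI : Convex ℝ I) (hu : ∀ k, IsDerivChain I (u k))
    (hv : Summable v) (hb : ∀ k n, ∀ x ∈ I, |u k n x| ≤ v k * B n) (c : ℕ → Bool) :
    IsDerivChain I (selectedSum u c) :=
  IsDerivChain.tsum (u := fun k n x => (if c k then 1 else 0) * u k n x) hI
    (fun k => (hu k).const_mul _) hv fun k n x hx =>
      (abs_select_mul_le (c k) _).trans (hb k n x hx)

theorem abs_selectedSum_le (hv : Summable v) (hb : ∀ k n, ∀ x ∈ I, |u k n x| ≤ v k * B n)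
    (c : ℕ → Bool) (n : ℕ) {x : ℝ} (hx : x ∈ I) :
    |selectedSum u c n x| ≤ (∑' k, v k) * B n := by
  rw [← tsum_mul_right]
  exact tsum_of_norm_bounded (E := ℝ) (hv.mul_right (B n)).hasSum fun k =>
    (abs_select_mul_le (c k) _).trans (hb k n x hx)

theorem continuous_selectedSum (hv : Summable v) (hb : ∀ k n, ∀ x ∈ I, |u k n x| ≤ v k * B n)
    (n : ℕ) {x : ℝ} (hx : x ∈ I) : Continuous fun c => selectedSum u c n x := by
  refine continuous_tsum (fun k => ?_) (hv.mul_right (B n)) fun k c =>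
    (abs_select_mul_le (c k) _).trans (hb k n x hx)
  have h : Continuous fun b : Bool => (if b then 1 else 0) * u k n x :=
    continuous_of_discreteTopology
  exact h.comp (continuous_apply k)

theorem selectedSum_update_sub (hv : Summable v) (hb : ∀ k n, ∀ x ∈ I, |u k n x| ≤ v k * B n)
    (c : ℕ → Bool) (k n : ℕ) {x : ℝ} (hx : x ∈ I) :
    selectedSum u (Function.update c k true) n x - selectedSum u (Function.update c k false) n x =
      u k n x := by
  rw [selectedSum, selectedSum, ← (summable_select_mul hv hb _ n hx).tsum_sub
    (summable_select_mul hv hb _ n hx), tsum_eq_single k]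
  · simp
  · intro j hj
    simp [Function.update_of_ne hj]

end SelectedSum

theorem tendsto_update_atTop (c : ℕ → Bool) (b : Bool) :
    Tendsto (fun k => Function.update c k b) atTop (𝓝 c) := by
  refine tendsto_pi_nhds.2 fun i => tendsto_const_nhds.congr' ?_
  filter_upwards [eventually_gt_atTop i] with k hk
  rw [Function.update_of_ne hk.ne]

/-! ### Extensions versus poles -/

/-- Two bounded chains that differ on `[0, δ]` by a simple fraction with pole left of `-δ` control
the value of the fraction at `-δ`. -/
theorem IsQuasianalytic.abs_pole_le {M : ℕ → ℝ} (hM : IsLogConvexWeight M)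
    (hq : IsQuasianalytic M) {δ C R : ℝ} (hδ : 0 < δ) (hC : 0 < C) (hR : 0 < R)
    {G H : ℕ → ℝ → ℝ}
    (hG : G ∈ boundedChains (Set.Icc (-δ) δ) fun n => C * R ^ n * (n.factorial : ℝ) * M n)
    (hH : H ∈ boundedChains (Set.Icc (-δ) δ) fun n => C * R ^ n * (n.factorial : ℝ) * M n)
    {a w : ℝ} (ha : δ < a) (he : ∀ x ∈ Set.Icc 0 δ, G 0 x - H 0 x = w * poleDeriv a 0 x) :
    |w * poleDeriv a 0 (-δ)| ≤ 2 * C := by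
  have hb : 0 < a - δ := sub_pos.2 ha
  have hGc := isDerivChain_of_mem_boundedChains hG
  have hHc := isDerivChain_of_mem_boundedChains hH
  have hP : IsDerivChain (Set.Icc (-δ) δ) (poleDeriv a) :=
    isDerivChain_poleDeriv fun x hx => by linarith [hx.1]
  have hch := (hGc.sub hHc).sub (hP.const_mul w)
  set r := (a - δ)⁻¹ with hr
  have hr0 : 0 < r := inv_pos.2 hb
  -- These constants depend on the pole but only certify class membership; the final bound `2 * C`
  -- comes from `G` and `H` at `-δ`.
  have hz := hq.apply_neg_eq_zero hδ hch (C := 2 * C + |w| * r) (R := R + r) (by positivity)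
    (by positivity) (fun n x hx => ?_) fun x hx => sub_eq_zero.2 (he x hx)
  · have h1 : w * poleDeriv a 0 (-δ) = G 0 (-δ) - H 0 (-δ) := (sub_eq_zero.1 hz).symm
    have hG0 := hG.1 0 (-δ)
    have hH0 := hH.1 0 (-δ)
    simp only [pow_zero, Nat.factorial_zero, Nat.cast_one, mul_one, hM.zero_eq_one] at hG0 hH0
    rw [h1]
    exact (abs_sub _ _).trans (by linarith)
  · have hM0 : 1 ≤ M n := hM.one_le n
    have h1 : C * R ^ n * (n.factorial : ℝ) * M n ≤ C * (R + r) ^ n * (n.factorial : ℝ) * M n := by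
      gcongr
      linarith
    have h2 : |w * poleDeriv a n x| ≤ |w| * r * (R + r) ^ n * (n.factorial : ℝ) * M n := by
      rw [abs_mul]
      calc |w| * |poleDeriv a n x| ≤ |w| * ((n.factorial : ℝ) * r ^ (n + 1)) := by
            gcongr
            exact abs_poleDeriv_le hb (by linarith [hx.1]) n
        _ = |w| * r * r ^ n * (n.factorial : ℝ) * 1 := by ring
        _ ≤ |w| * r * (R + r) ^ n * (n.factorial : ℝ) * M n := by
            gcongr
            linarith
    calc |G n x - H n x - w * poleDeriv a n x|
        ≤ |G n x - H n x| + |w * poleDeriv a n x| := abs_sub _ _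
      _ ≤ |G n x| + |H n x| + |w * poleDeriv a n x| := by gcongr; exact abs_sub _ _
      _ ≤ _ := by linarith [hG.1 n x, hH.1 n x]

/-- The extension property of a right-hand germ, with all constants controlled by one number. -/
theorem exists_mem_boundedChains_of_germ_eq {M : ℕ → ℝ} (hM : IsLogConvexWeight M) {f : ℝ → ℝ}
    (hf : (f : Germ (𝓝[≥] (0 : ℝ)) ℝ) ∈ restrictRight '' germs M) :
    ∃ m : ℕ, ∃ G ∈ boundedChains (Set.Icc (-(1 / (m + 1 : ℝ))) (1 / (m + 1 : ℝ)))
      (fun n => (m + 1 : ℝ) * (m + 1 : ℝ) ^ n * (n.factorial : ℝ) * M n),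
      ∀ x ∈ Set.Icc 0 (1 / (m + 1 : ℝ)), G 0 x = f x := by
  obtain ⟨_, ⟨ε, hε, g, ⟨hg, C, hC, R, hR, hb⟩, rfl⟩, hgf⟩ := hf
  rw [restrictRight_coe] at hgf
  have hev : ∀ᶠ x in 𝓝[≥] (0 : ℝ), g x = f x := Germ.coe_eq.1 hgf
  obtain ⟨η, hη, hηf⟩ := mem_nhdsGE_iff_exists_Icc_subset.1 hev
  obtain ⟨m₁, hm₁⟩ := exists_nat_one_div_lt (lt_min hε hη)
  obtain ⟨m₂, hm₂⟩ := exists_nat_ge (max C R)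
  set m := max m₁ m₂ with hm
  have hδ : 1 / (m + 1 : ℝ) ≤ min ε η := by
    refine le_trans ?_ hm₁.le
    gcongr
    exact le_max_left _ _
  have hmm : (m₂ : ℝ) ≤ m := by exact_mod_cast le_max_right _ _
  have hCm : C ≤ m + 1 := by linarith [le_max_left C R]
  have hRm : R ≤ m + 1 := by linarith [le_max_right C R]
  have hsub : Set.Icc (-(1 / (m + 1 : ℝ))) (1 / (m + 1 : ℝ)) ⊆ Set.Icc (-ε) ε := by
    have := hδ.trans (min_le_left _ _)
    exact Set.Icc_subset_Icc (by linarith) this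
  have hch := (hg.isDerivChain_iteratedDerivWithin (uniqueDiffOn_Icc (by linarith))).mono hsub
  have hM0 : ∀ n, 0 ≤ M n := fun n => zero_le_one.trans (hM.one_le n)
  refine ⟨m, _, hch.indicator_mem_boundedChains (convex_Icc _ _) (fun n => ?_)
    (fun n x hx => (hb n x (hsub hx)).trans ?_), fun x hx => ?_⟩
  · have := hM0 n
    positivity
  · have := hM0 n
    gcongr
  · have hx' : x ∈ Set.Icc (-(1 / (m + 1 : ℝ))) (1 / (m + 1 : ℝ)) :=
      ⟨(neg_nonpos.2 (by positivity)).trans hx.1, hx.2⟩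
    rw [Set.indicator_of_mem hx', iteratedDerivWithin_zero]
    exact hηf ⟨hx.1, hx.2.trans (hδ.trans (min_le_right _ _))⟩

/-- Simple fractions `w k / (x + a k)`, uniformly summable in the class of `M` on `[0, ∞)`, whose
poles `-a k` approach every `-1 / (m + 1)` from the left while the values there blow up. -/
theorem IsLogConvexWeight.exists_poles {M : ℕ → ℝ} (hM : IsLogConvexWeight M)
    (hne : ¬ germs M ⊆ analyticGerms) :
    ∃ a w : ℕ → ℝ, (∀ k, 0 < a k) ∧
      (∀ k n, ∀ x ∈ Set.Ici (0 : ℝ),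
        |w k * poleDeriv (a k) n x| ≤ (1 / 2) ^ k * ((n.factorial : ℝ) * M n)) ∧
      ∀ m : ℕ, ∀ C : ℝ, ∃ᶠ k in atTop, 1 / (m + 1 : ℝ) < a k ∧
        C < |w k * poleDeriv (a k) 0 (-(1 / (m + 1 : ℝ)))| := by
  have hex : ∀ m : ℕ, ∃ D > 0, ∀ n, (m + 1 : ℝ) ^ (n + 1) ≤ D * M n :=
    fun m => hM.exists_pow_le hne (by positivity)
  choose D hD hDM using hex
  -- The first component of `Nat.unpair k` takes each value `m` infinitely often. The weight `(1 /
  -- 2) ^ k / D m` against the distance `(1 / 4) ^ k` to the pole gives the value `2 ^ k / D m`.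
  refine ⟨fun k => 1 / ((Nat.unpair k).1 + 1 : ℝ) + (1 / 4) ^ k,
    fun k => (1 / 2) ^ k / D (Nat.unpair k).1, fun k => by positivity, fun k n x hx => ?_,
    fun m C => ?_⟩
  · set m := (Nat.unpair k).1
    have h1 : |poleDeriv (1 / (m + 1 : ℝ) + (1 / 4) ^ k) n x| ≤
        (n.factorial : ℝ) * (D m * M n) := by
      refine (abs_poleDeriv_le (b := 1 / (m + 1 : ℝ)) (by positivity) ?_ n).trans ?_
      · have h2 : (0 : ℝ) ≤ (1 / 4) ^ k := by positivity
        have h3 : (0 : ℝ) ≤ x := hx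
        linarith
      · rw [one_div, inv_inv]
        gcongr
        exact hDM m n
    have hDm := hD m
    rw [abs_mul, abs_of_pos (by positivity)]
    calc (1 / 2) ^ k / D m * |poleDeriv (1 / (m + 1 : ℝ) + (1 / 4) ^ k) n x|
        ≤ (1 / 2) ^ k / D m * ((n.factorial : ℝ) * (D m * M n)) := by gcongr
      _ = _ := by field_simp
  · have hDm := hD m
    have hval : ∀ k, (Nat.unpair k).1 = m →
        |(1 / 2 : ℝ) ^ k / D (Nat.unpair k).1 *
          poleDeriv (1 / ((Nat.unpair k).1 + 1 : ℝ) + (1 / 4) ^ k) 0 (-(1 / (m + 1 : ℝ)))| =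
          2 ^ k / D m := by
      intro k hk
      rw [hk, poleDeriv, neg_add_cancel_left, abs_of_nonneg (by positivity)]
      have : (4 : ℝ) ^ k = 2 ^ k * 2 ^ k := by rw [← mul_pow]; norm_num
      simp only [pow_zero, Nat.factorial_zero, Nat.cast_one, zero_add, pow_one, one_mul, one_div,
        inv_pow, inv_inv, this]
      field_simp
    rw [frequently_atTop]
    intro K
    obtain ⟨j, hj⟩ := pow_unbounded_of_one_lt (C * D m) (one_lt_two : (1 : ℝ) < 2)
    refine ⟨Nat.pair m (max K j), (le_max_left K j).trans (Nat.right_le_pair _ _), ?_, ?_⟩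
    · simp only [Nat.unpair_pair]
      exact lt_add_of_pos_right _ (by positivity)
    · rw [hval _ (by simp), lt_div_iff₀ hDm]
      refine hj.trans_le (pow_le_pow_right₀ one_le_two ?_)
      exact (le_max_right K j).trans (Nat.right_le_pair _ _)

end DenjoyCarleman

/-! ### The Baire category argument -/

open DenjoyCarleman in
theorem theorem3p2 (M : ℕ → ℝ) (N : ℕ → ℕ → ℝ)
    (hM : DenjoyCarleman.IsLogConvexWeight M)
    (hN : ∀ p : ℕ, DenjoyCarleman.IsLogConvexWeight (N p))
    (hNmono : ∀ p q : ℕ, p ≤ q → ∀ j : ℕ, N p j ≤ N q j)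
    (hquasi : ∀ p : ℕ, DenjoyCarleman.IsQuasianalytic (N p))
    (hproper : DenjoyCarleman.analyticGerms ⊂ DenjoyCarleman.germs M)
    (hsub : DenjoyCarleman.germs M ⊆ ⋃ p : ℕ, DenjoyCarleman.germs (N p)) :
    (DenjoyCarleman.rightGerms M \
      DenjoyCarleman.restrictRight '' (⋃ p : ℕ, DenjoyCarleman.germs (N p))).Nonempty := by
  obtain ⟨a, w, ha, hbound, hblow⟩ := hM.exists_poles hproper.2
  let u : ℕ → ℕ → ℝ → ℝ := fun k n x => w k * poleDeriv (a k) n x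
  have hv : Summable fun k : ℕ => (1 / 2 : ℝ) ^ k := summable_geometric_two
  have hu : ∀ k, IsDerivChain (Set.Ici 0) (u k) := fun k =>
    (isDerivChain_poleDeriv fun x (hx : 0 ≤ x) => (add_pos_of_nonneg_of_pos hx (ha k)).ne').const_mul
      (w k)
  have hright : ∀ c, (selectedSum u c 0 : Germ (𝓝[≥] (0 : ℝ)) ℝ) ∈ rightGerms M := by
    intro c
    refine ⟨1, one_pos, _, ?_, rfl⟩
    refine ((isDerivChain_selectedSum (convex_Ici 0) hu hv hbound c).mono
      Set.Icc_subset_Ici_self).mem_carlemanClass (uniqueDiffOn_Icc one_pos)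
      (hv.tsum_pos (fun k => by positivity) 0 (by norm_num)) one_pos fun n x hx => ?_
    rw [one_pow, mul_one, mul_assoc]
    exact abs_selectedSum_le hv hbound c n (Set.Icc_subset_Ici_self hx)
  by_contra hempty
  rw [Set.not_nonempty_iff_eq_empty, Set.sdiff_eq_empty] at hempty
  let A : ℕ × ℕ → Set (ℕ → Bool) := fun i =>
    {c | ∃ G ∈ boundedChains (Set.Icc (-(1 / (i.2 + 1 : ℝ))) (1 / (i.2 + 1 : ℝ)))
      (fun n => (i.2 + 1 : ℝ) * (i.2 + 1 : ℝ) ^ n * (n.factorial : ℝ) * N i.1 n),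
      ∀ x ∈ Set.Icc 0 (1 / (i.2 + 1 : ℝ)), G 0 x = selectedSum u c 0 x}
  have hclosed : ∀ i, IsClosed (A i) := fun i =>
    isClosed_setOf_exists_boundedChains _ _ _ fun x hx =>
      continuous_selectedSum hv hbound 0 (Set.Icc_subset_Ici_self hx)
  have hcover : ⋃ i, A i = Set.univ := by
    refine Set.eq_univ_of_forall fun c => ?_
    obtain ⟨g, hg, hgc⟩ := hempty (hright c)
    obtain ⟨p, hp⟩ := Set.mem_iUnion.1 hg
    obtain ⟨m, hm⟩ := exists_mem_boundedChains_of_germ_eq (hN p) ⟨g, hp, hgc⟩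
    exact Set.mem_iUnion.2 ⟨(p, m), hm⟩
  obtain ⟨⟨p, m⟩, c, hc⟩ := nonempty_interior_of_iUnion_of_closed hclosed hcover
  -- A neighbourhood in the product topology constrains finitely many coordinates, so late ones are
  -- free.
  have hev : ∀ b, ∀ᶠ k in atTop, Function.update c k b ∈ A (p, m) := fun b =>
    tendsto_update_atTop c b (mem_interior_iff_mem_nhds.1 hc)
  obtain ⟨k, ⟨hak, hlarge⟩, ⟨G, hG, hGc⟩, H, hH, hHc⟩ :=
    ((hblow m (2 * (m + 1 : ℝ))).and_eventually ((hev true).and (hev false))).exists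
  refine hlarge.not_ge ((hquasi p).abs_pole_le (hN p) (by positivity) (by positivity)
    (by positivity) hG hH hak fun x hx => ?_)
  rw [hGc x hx, hHc x hx]
  exact selectedSum_update_sub hv hbound c k 0 (Set.Icc_subset_Ici_self hx)
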